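/- Let $\mathcal X$ be a nonempty compact metrizable space, $T:\mathcal X\to\mathcal X$ a homeomorphism, and $\mathcal F=\{\varphi_n\}_{n\ge1}$ a sub-additive potential: each $\varphi_n:\mathcal X\to\mathbb R$ is continuous and $\varphi_{n+m}(x)\le\varphi_n(x)+\varphi_m(T^nx)$ for all $x\in\mathcal X$, $n,m\ge1$. For a metric $d$ on $\mathcal X$ compatible with the topology put $d_N(x,y)=\max_{0\le n<N}d(T^nx,T^ny)$. All quantities below take values in $[-\infty,\infty]$. * For $\epsilon>0$ and a continuous $\varphi:\mathcal X\to\mathbb R$, let $\mathrm{Widim}_\epsilon(\mathcal X,d,\varphi)$ be the infimum of $\max_{x\in\mathcal X}(\dim_{f(x)}P+\varphi(x))$ over all finite simplicial complexes $P$ and all continuous $f:\mathcal X\to P$ with $\mathrm{diam}\,f^{-1}(y)<\epsilon$ for every $y\in P$, where $\dim_aP$ is the maximal dimension of a simplex of $P$ containing $a$. Set $$\mathrm{mdim}(\mathcal X,T,\mathcal F)=\lim_{\epsilon\to0}\Bigl(\lim_{N\to\infty}\frac{\mathrm{Widim}_\epsilon(\mathcal X,d_N,\varphi_N)}{N}\Bigr),$$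 which does not depend on the choice of the compatible metric $d$. * Let $\#(\mathcal X,d,\varphi,\epsilon)$ be the infimum of $\sum_{i=1}^n(1/\epsilon)^{\sup_{U_i}\varphi}$ over finite covers $\mathcal X=U_1\cup\dots\cup U_n$ by nonempty open sets with $\mathrm{diam}\,U_i<\epsilon$. Set $$P(\mathcal X,T,d,\mathcal F,\epsilon)=\lim_{N\to\infty}\frac{\log\#(\mathcal X,d_N,\varphi_N,\epsilon)}{N},\qquad \underline{\mathrm{mdim}}_M(\mathcal X,T,d,\mathcal F)=\liminf_{\epsilon\to0}\frac{P(\mathcal X,T,d,\mathcal F,\epsilon)}{\log(1/\epsilon)}.$$ * For $s\ge\max\varphi$ let $H^s_\epsilon(\mathcal X,d,\varphi)$ be the infimum of $\sum_{i=1}^\infty(\mathrm{diam}\,E_i)^{s-\sup_{E_i}\varphi}$ over covers $\mathcal X=\bigcup_{i\ge1}E_i$ with $\mathrm{diam}\,E_i<\epsilon$ (where $0^0=1$ and the term of an empty set is $0$), and let $\dim_H(\mathcal X,d,\varphi,\epsilon)$ be the supremum of the real numbers $s\ge\max\varphi$ with $H^s_\epsilon(\mathcal X,d,\varphi)\ge1$.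 Set $$\mathrm{mdim}_H(\mathcal X,T,d,\mathcal F)=\lim_{\epsilon\to0}\Bigl(\limsup_{N\to\infty}\frac{\dim_H(\mathcal X,d_N,\varphi_N,\epsilon)}{N}\Bigr).$$ (The limits in these definitions exist: the quantities concerned are sub-additive in $N$, respectively monotone in $\epsilon$.) Then, for every compatible metric $d$ on $\mathcal X$, $$\mathrm{mdim}_H(\mathcal X,T,d,\mathcal F)\le\underline{\mathrm{mdim}}_M(\mathcal X,T,d,\mathcal F).$$ If in addition $\mathcal F$ has bounded distortion, i.e. $$\lim_{\epsilon\to0}\limsup_{n\to\infty}\frac1n\sup\{|\varphi_n(x)-\varphi_n(y)|:d_n(x,y)<\epsilon\}=0,$$ and there is $K>0$ such that $|\varphi_{n+1}(x)-\varphi_n(x)|<K$ for all $n\ge1$ and $x\in\mathcal X$, then $$\mathrm{mdim}(\mathcal X,T,\mathcal F)\le\mathrm{mdim}_H(\mathcal X,T,d,\mathcal F).$$ -/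

import Mathlib

open Filter Topology
open scoped ENNReal

namespace SubadditiveMeanDim

variable {X : Type*}

/-- `ρ` is the distance function of a metric on `X` that induces the given topology. -/
def IsCompatibleMetric [t : TopologicalSpace X] (ρ : X → X → ℝ) : Prop :=
  ∃ m : MetricSpace X, m.toUniformSpace.toTopologicalSpace = t ∧ ∀ x y, m.dist x y = ρ x y

/-- The Bowen metric `d_N(x, y) = max_{0 ≤ n < N} d(Tⁿ x, Tⁿ y)`. -/
noncomputable def bowenDist (T : X → X) (d : X → X → ℝ) (N : ℕ) (x y : X) : ℝ :=
  ⨆ n : Fin N, d (T^[n] x) (T^[n] y)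

/-- The diameter of a set with respect to the distance function `d` (`0` for the empty set). -/
noncomputable def diamOf (d : X → X → ℝ) (E : Set X) : ℝ≥0∞ :=
  ⨆ x ∈ E, ⨆ y ∈ E, ENNReal.ofReal (d x y)

/-- A sub-additive potential `(φ_n)_{n ≥ 1}`: continuous functions such that
`φ_{n+m} ≤ φ_n + φ_m ∘ Tⁿ`. The value of `φ` at the index `0` plays no role. -/
structure IsSubadditivePotential [TopologicalSpace X] (T : X → X) (φ : ℕ → X → ℝ) : Prop where
  continuous : ∀ n, 1 ≤ n → Continuous (φ n)
  subadditive : ∀ n m, 1 ≤ n → 1 ≤ m → ∀ x, φ (n + m) x ≤ φ n x + φ m (T^[n] x)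

/-- The oscillation `var_ε(φ, d) = sup {|φ x - φ y| : d(x, y) < ε}`. -/
noncomputable def varOf (d : X → X → ℝ) (φ : X → ℝ) (ε : ℝ) : EReal :=
  ⨆ (x : X) (y : X) (_ : d x y < ε), ((|φ x - φ y| : ℝ) : EReal)

/-- Bounded distortion: `lim_{ε → 0} limsup_{n → ∞} var_ε(φ_n, d_n) / n = 0`. -/
def BoundedDistortion (T : X → X) (d : X → X → ℝ) (φ : ℕ → X → ℝ) : Prop :=
  Tendsto (fun ε : ℝ =>
      limsup (fun n : ℕ => varOf (bowenDist T d n) (φ n) ε / (n : EReal)) atTop)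
    (𝓝[>] 0) (𝓝 0)

/-! ### Mean topological dimension -/

/-- The local dimension of a simplicial complex `P` at a point `a`: the largest dimension of a
simplex of `P` that contains `a`. -/
noncomputable def localDim {k : ℕ} (P : Geometry.SimplicialComplex ℝ (EuclideanSpace ℝ (Fin k)))
    (a : EuclideanSpace ℝ (Fin k)) : ℕ :=
  sSup {n | ∃ s ∈ P.faces, a ∈ convexHull ℝ (s : Set (EuclideanSpace ℝ (Fin k))) ∧
    s.card = n + 1}

/-- The `ε`-width dimension with potential: the infimum of `max_x (dim_{f(x)} P + φ(x))` over the
finite simplicial complexes `P` (realised in some `ℝᵏ`) and the `ε`-embeddings `f : X → P`. -/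
noncomputable def widim [TopologicalSpace X] (d : X → X → ℝ) (φ : X → ℝ) (ε : ℝ) : EReal :=
  sInf {r : EReal | ∃ (k : ℕ) (P : Geometry.SimplicialComplex ℝ (EuclideanSpace ℝ (Fin k)))
    (f : X → EuclideanSpace ℝ (Fin k)),
      P.faces.Finite ∧ Continuous f ∧ (∀ x, f x ∈ P.space) ∧
      (∀ a, diamOf d (f ⁻¹' {a}) < ENNReal.ofReal ε) ∧
      r = ⨆ x, (((localDim P (f x) : ℝ) + φ x : ℝ) : EReal)}

/-- Mean topological dimension with sub-additive potential, computed with the metric `d`: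
`lim_{ε → 0} lim_{N → ∞} Widim_ε(X, d_N, φ_N) / N`. For a sub-additive potential on a compact
space both limits exist (sub-additivity in `N`, monotonicity in `ε`), and so they are equal to the
upper limits used here. -/
noncomputable def mdim [TopologicalSpace X] (T : X → X) (d : X → X → ℝ) (φ : ℕ → X → ℝ) : EReal :=
  limsup (fun ε : ℝ =>
      limsup (fun N : ℕ => widim (bowenDist T d N) (φ N) ε / (N : EReal)) atTop)
    (𝓝[>] 0)

/-! ### Metric mean dimension -/

/-- The weighted covering number `#(X, d, φ, ε)`: the infimum of `∑ (1/ε)^{sup_{U_i} φ}` over the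
finite covers of `X` by (nonempty) open sets `U_i` with `diam U_i < ε`. -/
noncomputable def coverNumber [TopologicalSpace X] (d : X → X → ℝ) (φ : X → ℝ) (ε : ℝ) : ℝ≥0∞ :=
  sInf {r : ℝ≥0∞ | ∃ (n : ℕ) (U : Fin n → Set X),
      (∀ i, IsOpen (U i) ∧ (U i).Nonempty ∧ diamOf d (U i) < ENNReal.ofReal ε) ∧
      (⋃ i, U i) = Set.univ ∧
      r = ∑ i, ENNReal.ofReal (1 / ε) ^ (sSup (φ '' U i))}

/-- `P(X, T, d, F, ε) = lim_{N → ∞} log #(X, d_N, φ_N, ε) / N`. For a sub-additive potential on a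
compact space the limit exists (sub-additivity in `N`), and so it is equal to the upper limit used
here. -/
noncomputable def pressure [TopologicalSpace X] (T : X → X) (d : X → X → ℝ) (φ : ℕ → X → ℝ)
    (ε : ℝ) : EReal :=
  limsup (fun N : ℕ => ENNReal.log (coverNumber (bowenDist T d N) (φ N) ε) / (N : EReal)) atTop

/-- Lower metric mean dimension with sub-additive potential:
`liminf_{ε → 0} P(X, T, d, F, ε) / log (1/ε)`. -/
noncomputable def lowerMdimM [TopologicalSpace X] (T : X → X) (d : X → X → ℝ)
    (φ : ℕ → X → ℝ) : EReal :=
  liminf (fun ε : ℝ => pressure T d φ ε / ((Real.log (1 / ε) : ℝ) : EReal)) (𝓝[>] 0)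

/-! ### Mean Hausdorff dimension -/

open Classical in
/-- The weight `(diam E)^{s - sup_E φ}`, with `0⁰ = 1`, and with weight `0` for the empty set. -/
noncomputable def hausdorffWeight (d : X → X → ℝ) (φ : X → ℝ) (s : ℝ) (E : Set X) : ℝ≥0∞ :=
  if E = ∅ then 0 else diamOf d E ^ (s - sSup (φ '' E))

/-- `H_ε^s(X, d, φ)`: the infimum of `∑ (diam E_i)^{s - sup_{E_i} φ}` over the countable covers of
`X` by sets `E_i` with `diam E_i < ε`. -/
noncomputable def hausdorffSum (d : X → X → ℝ) (φ : X → ℝ) (ε s : ℝ) : ℝ≥0∞ :=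
  sInf {r : ℝ≥0∞ | ∃ E : ℕ → Set X,
      (⋃ i, E i) = Set.univ ∧ (∀ i, diamOf d (E i) < ENNReal.ofReal ε) ∧
      r = ∑' i, hausdorffWeight d φ s (E i)}

/-- `dim_H(X, d, φ, ε)`: the supremum of the real numbers `s ≥ max φ` with
`H_ε^s(X, d, φ) ≥ 1`. -/
noncomputable def dimHWith (d : X → X → ℝ) (φ : X → ℝ) (ε : ℝ) : EReal :=
  sSup {r : EReal | ∃ s : ℝ, (∀ x, φ x ≤ s) ∧ 1 ≤ hausdorffSum d φ ε s ∧ r = (s : EReal)}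

/-- Mean Hausdorff dimension with sub-additive potential:
`lim_{ε → 0} limsup_{N → ∞} dim_H(X, d_N, φ_N, ε) / N`. The limit exists by monotonicity in `ε`,
and so it is equal to the upper limit used here. -/
noncomputable def mdimH (T : X → X) (d : X → X → ℝ) (φ : ℕ → X → ℝ) : EReal :=
  limsup (fun ε : ℝ =>
      limsup (fun N : ℕ => dimHWith (bowenDist T d N) (φ N) ε / (N : EReal)) atTop)
    (𝓝[>] 0)

end SubadditiveMeanDim

/-!
For the first inequality, a finite open cover by sets of diameter less than `ε < 1` is also
admissible for the weighted Hausdorff sum, and each weight satisfies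
`(diam U) ^ (s - sup_U φ) ≤ ε ^ s * (1 / ε) ^ sup_U φ`. Hence `H_ε^s ≥ 1` forces
`# ≥ (1 / ε) ^ s`, that is, `dim_H ≤ log # / log (1 / ε)` at every scale and every time `N`
(`dimHWith_le_log_coverNumber_div`); the limits follow because `dim_H` is antitone in `ε`.

For the second inequality, fix a scale `r` and a Lipschitz map `f : X → ℝ^J` such that points at
distance at least `r` have some coordinate that is `≤ 0` at the one and `≥ 1` at the other
(`exists_lipschitz_separating`). The orbit map `F = (f, f ∘ T, …, f ∘ T^(N-1))` then does the same
for `d_N`, with the same Lipschitz constant for the sup norm. If `s / N` exceeds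
`dim_H(X, d_N, φ_N, ε) / N`, a cover with weighted Hausdorff sum less than `1` shows that, for `ε`
small and independent of `N`, the levels `t` in the cube `(0,1)^(N × J)` that agree with `F x` in at
least `s + κN - φ_N x` coordinates, for some `x`, have volume less than `1`. So there is a level `t`
which each `F x` meets, or nearly meets, in fewer than `s + κN - φ_N x` coordinates
(`exists_level`, `exists_margin`). Expanding the coordinates affinely around `t` pushes `F x` onto a
low-dimensional face of the cube, while separated points stay on opposite faces.

Barycentric coordinates in the triangulation of the cube by chains of subsets (`cubeCoord`) pull
back to a partition of unity on `X`. Its supports are small and its order at `x` is at most one more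
than the number of coordinates nearly met. Its nerve is a complex whose local dimension at the image
of `x` is bounded by the order at a point `y` close to `x` for `d_N` (`exists_localDim_nerve_lt`).
Bounded distortion absorbs the difference of `φ_N x` and `φ_N y`. Closeness for `d_N` at a small
scale implies closeness for `ρ_N`, for any other compatible metric `ρ`
(`IsCompatibleMetric.exists_forall_lt`).
-/

namespace SubadditiveMeanDim

variable {X : Type*}

/-! ### Mean Hausdorff dimension and metric mean dimension -/

lemma rpow_le_coverNumber_of_one_le_hausdorffSum [TopologicalSpace X] {d : X → X → ℝ}
    {φ : X → ℝ} {ε s : ℝ} (hε : 0 < ε) (hs : ∀ x, φ x ≤ s) (h : 1 ≤ hausdorffSum d φ ε s) :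
    ENNReal.ofReal (1 / ε) ^ s ≤ coverNumber d φ ε := by
  refine le_sInf ?_
  rintro r ⟨n, U, hU, hcov, rfl⟩
  set b := ENNReal.ofReal (1 / ε) with hb
  have hb0 : b ≠ 0 := by simpa [hb] using hε
  have hbt : b ≠ ⊤ := ENNReal.ofReal_ne_top
  have hbinv : ENNReal.ofReal ε = b⁻¹ := by
    rw [hb, ← ENNReal.ofReal_inv_of_pos (by positivity)]; simp
  let E : ℕ → Set X := fun i => if hi : i < n then U ⟨i, hi⟩ else ∅
  have hE : ∀ i : Fin n, E i = U i := fun i => by simp [E]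
  have hsum : ∑' i, hausdorffWeight d φ s (E i) = ∑ i : Fin n, hausdorffWeight d φ s (U i) := by
    rw [tsum_eq_sum (s := Finset.range n), ← Fin.sum_univ_eq_sum_range
      (fun i => hausdorffWeight d φ s (E i))]
    · simp [hE]
    · intro i hi
      have : ¬ i < n := by simpa using hi
      simp [E, this, hausdorffWeight]
  have hH : (1 : ℝ≥0∞) ≤ ∑ i : Fin n, hausdorffWeight d φ s (U i) := by
    rw [← hsum]
    refine h.trans (sInf_le ⟨E, ?_, ?_, rfl⟩)
    · refine Set.eq_univ_of_forall fun x => ?_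
      have hx : x ∈ ⋃ i, U i := hcov ▸ Set.mem_univ x
      obtain ⟨i, hi⟩ := Set.mem_iUnion.1 hx
      exact Set.mem_iUnion.2 ⟨i, by rwa [hE]⟩
    · intro i
      by_cases hi : i < n
      · simpa [E, hi] using (hU ⟨i, hi⟩).2.2
      · simpa [E, hi, diamOf] using hε
  have hw : ∀ i, hausdorffWeight d φ s (U i) ≤ b ^ (-s) * b ^ sSup (φ '' U i) := by
    intro i
    obtain ⟨-, hne, hdiam⟩ := hU i
    have hsup : sSup (φ '' U i) ≤ s := csSup_le (hne.image φ) (by rintro _ ⟨x, -, rfl⟩; exact hs x)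
    rw [hausdorffWeight, if_neg hne.ne_empty, ← ENNReal.rpow_add _ _ hb0 hbt]
    calc diamOf d (U i) ^ (s - sSup (φ '' U i)) ≤ (b⁻¹) ^ (s - sSup (φ '' U i)) :=
          ENNReal.rpow_le_rpow (hbinv ▸ hdiam.le) (by linarith)
      _ = b ^ (-s + sSup (φ '' U i)) := by
          rw [ENNReal.inv_rpow, ← ENNReal.rpow_neg]; congr 1; ring
  calc b ^ s = b ^ s * 1 := (mul_one _).symm
    _ ≤ b ^ s * ∑ i, b ^ (-s) * b ^ sSup (φ '' U i) := by
        gcongr; exact hH.trans (Finset.sum_le_sum fun i _ => hw i)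
    _ = ∑ i, b ^ sSup (φ '' U i) := by
        rw [← Finset.mul_sum, ← mul_assoc, ← ENNReal.rpow_add _ _ hb0 hbt]; simp

lemma dimHWith_le_log_coverNumber_div [TopologicalSpace X] {d : X → X → ℝ} {φ : X → ℝ} {ε : ℝ}
    (hε : 0 < ε) (hε1 : ε < 1) :
    dimHWith d φ ε ≤ ENNReal.log (coverNumber d φ ε) / ((Real.log (1 / ε) : ℝ) : EReal) := by
  have hlog : 0 < Real.log (1 / ε) := Real.log_pos (by rw [lt_div_iff₀ hε]; linarith)
  refine sSup_le ?_
  rintro _ ⟨s, hs, hH, rfl⟩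
  rw [EReal.le_div_iff_mul_le (by exact_mod_cast hlog) (EReal.coe_ne_top _),
    ← ENNReal.log_ofReal_of_pos (by positivity), ← ENNReal.log_rpow]
  exact ENNReal.log_monotone (rpow_le_coverNumber_of_one_le_hausdorffSum hε hs hH)

lemma hausdorffSum_antitone (d : X → X → ℝ) (φ : X → ℝ) (s : ℝ) :
    Antitone fun ε => hausdorffSum d φ ε s := by
  intro ε ε' h
  refine sInf_le_sInf ?_
  rintro r ⟨E, hcov, hE, rfl⟩
  exact ⟨E, hcov, fun i => (hE i).trans_le (ENNReal.ofReal_le_ofReal h), rfl⟩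

lemma dimHWith_antitone (d : X → X → ℝ) (φ : X → ℝ) : Antitone (dimHWith d φ) := by
  intro ε ε' h
  refine sSup_le_sSup ?_
  rintro _ ⟨s, hs, hH, rfl⟩
  exact ⟨s, hs, hH.trans (hausdorffSum_antitone d φ s h), rfl⟩

theorem mdimH_le_lowerMdimM [TopologicalSpace X] (T : X → X) (d : X → X → ℝ) (φ : ℕ → X → ℝ) :
    mdimH T d φ ≤ lowerMdimM T d φ := by
  refine limsup_le_of_le (h := ?_)
  filter_upwards [self_mem_nhdsWithin] with ε₀ (hε₀ : 0 < ε₀)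
  refine le_liminf_of_le (h := ?_)
  filter_upwards [Ioo_mem_nhdsGT (lt_min hε₀ one_pos)] with ε ⟨hε, hεlt⟩
  have hlog : 0 < Real.log (1 / ε) :=
    Real.log_pos (by rw [lt_div_iff₀ hε]; linarith [hεlt.trans_le (min_le_right _ _)])
  set c : EReal := ((Real.log (1 / ε) : ℝ) : EReal)⁻¹ with hc
  have hc0 : 0 ≤ c := EReal.inv_nonneg_of_nonneg (by exact_mod_cast hlog.le)
  have hct : c ≠ ⊤ := by rw [hc, ← EReal.coe_inv]; exact EReal.coe_ne_top _
  rw [pressure, EReal.div_eq_inv_mul, ← EReal.limsup_const_mul_of_nonneg_of_ne_top hc0 hct]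
  refine limsup_le_limsup (Eventually.of_forall fun N => ?_)
  calc dimHWith (bowenDist T d N) (φ N) ε₀ / (N : EReal)
      ≤ (c * ENNReal.log (coverNumber (bowenDist T d N) (φ N) ε)) / (N : EReal) := by
        refine EReal.monotone_div_right_of_nonneg (by positivity) ?_
        rw [hc, ← EReal.div_eq_inv_mul]
        exact (dimHWith_antitone _ _ (hεlt.le.trans (min_le_left _ _))).trans
          (dimHWith_le_log_coverNumber_div hε (hεlt.trans_le (min_le_right _ _)))
    _ = c * (ENNReal.log (coverNumber (bowenDist T d N) (φ N) ε) / (N : EReal)) := by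
        simp only [EReal.div_eq_inv_mul]; rw [mul_left_comm]

/-! ### A partition of unity on the cube -/

section Cube

variable {ι : Type*} [Fintype ι]

/-- The barycentric coordinate of `a ∈ [0,1]^ι` at the vertex `1_S` of the cube, in the
triangulation of the cube whose simplices are the chains of subsets of `ι`. It is the length of the
set of levels `θ ∈ (0, 1]` with `{k | θ ≤ a k} = S`. For `a` outside the cube it is the coordinate of
the nearest point of the cube, since the folds start from `1` and `0`. -/
noncomputable def cubeCoord (S : Finset ι) (a : ι → ℝ) : ℝ :=
  open Classical in max 0 (S.fold min 1 a - Sᶜ.fold max 0 a)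

lemma cubeCoord_nonneg (S : Finset ι) (a : ι → ℝ) : 0 ≤ cubeCoord S a := le_max_left _ _

lemma continuous_cubeCoord (S : Finset ι) : Continuous (cubeCoord S) := by
  classical
  have h₁ : ∀ S : Finset ι, Continuous fun a : ι → ℝ => S.fold min 1 a := by
    intro S
    induction S using Finset.induction_on with
    | empty => simpa using continuous_const
    | insert k S hk ih => simp only [Finset.fold_insert hk]; fun_prop
  have h₂ : ∀ S : Finset ι, Continuous fun a : ι → ℝ => S.fold max 0 a := by
    intro S
    induction S using Finset.induction_on with
    | empty => simpa using continuous_const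
    | insert k S hk ih => simp only [Finset.fold_insert hk]; fun_prop
  unfold cubeCoord
  exact (continuous_const (y := (0 : ℝ))).max ((h₁ S).sub (h₂ _))

open Classical in
lemma mem_Ioc_fold_iff (S : Finset ι) (a : ι → ℝ) (θ : ℝ) :
    θ ∈ Set.Ioc (Sᶜ.fold max 0 a) (S.fold min 1 a) ↔
      θ ∈ Set.Ioc 0 1 ∧ S = Finset.univ.filter fun k => θ ≤ a k := by
  rw [Set.mem_Ioc, Finset.fold_max_lt, Finset.le_fold_min, Set.mem_Ioc]
  constructor
  · rintro ⟨⟨h0, hc⟩, h1, hS⟩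
    refine ⟨⟨h0, h1⟩, ?_⟩
    ext k
    simp only [Finset.mem_filter, Finset.mem_univ, true_and]
    refine ⟨hS k, fun hk => ?_⟩
    by_contra hkS
    exact absurd (hc k (by simpa using hkS)) (not_lt.2 hk)
  · rintro ⟨⟨h0, h1⟩, rfl⟩
    simp [h0, h1]

open Classical in
lemma exists_level_of_cubeCoord_pos {S : Finset ι} {a : ι → ℝ} (h : 0 < cubeCoord S a) :
    ∃ θ ∈ Set.Ioc (0 : ℝ) 1, S = Finset.univ.filter fun k => θ ≤ a k := by
  have h' : Sᶜ.fold max 0 a < S.fold min 1 a := by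
    simpa [cubeCoord] using h
  exact ⟨_, (mem_Ioc_fold_iff S a _).1 ⟨h', le_rfl⟩⟩

lemma sum_cubeCoord (a : ι → ℝ) : ∑ S, cubeCoord S a = 1 := by
  classical
  have hU : (⋃ S : Finset ι, Set.Ioc (Sᶜ.fold max 0 a) (S.fold min 1 a)) = Set.Ioc (0 : ℝ) 1 := by
    ext θ
    simp only [Set.mem_iUnion, mem_Ioc_fold_iff]
    exact ⟨fun ⟨_, h, _⟩ => h, fun h => ⟨_, h, rfl⟩⟩
  have hd : Pairwise (Function.onFun Disjoint
      fun S : Finset ι => Set.Ioc (Sᶜ.fold max 0 a) (S.fold min 1 a)) := by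
    intro S S' hne
    refine Set.disjoint_left.2 fun θ h h' => hne ?_
    rw [((mem_Ioc_fold_iff S a θ).1 h).2, ((mem_Ioc_fold_iff S' a θ).1 h').2]
  have := MeasureTheory.measureReal_iUnion_fintype (μ := MeasureTheory.volume) hd
    (fun S => measurableSet_Ioc) (fun S => by simp)
  rw [hU] at this
  simp only [Real.volume_real_Ioc] at this
  norm_num at this
  rw [this]
  refine Finset.sum_congr rfl fun S _ => ?_
  rw [cubeCoord, max_comm]

lemma notMem_of_cubeCoord_pos {S : Finset ι} {a : ι → ℝ} (h : 0 < cubeCoord S a) {k : ι}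
    (hk : a k ≤ 0) : k ∉ S := by
  classical
  obtain ⟨θ, hθ, rfl⟩ := exists_level_of_cubeCoord_pos h
  simpa using hk.trans_lt hθ.1

lemma mem_of_cubeCoord_pos {S : Finset ι} {a : ι → ℝ} (h : 0 < cubeCoord S a) {k : ι}
    (hk : 1 ≤ a k) : k ∈ S := by
  classical
  obtain ⟨θ, hθ, rfl⟩ := exists_level_of_cubeCoord_pos h
  simpa using hθ.2.trans hk

/-- A point of the open face of dimension `n` of the cube lies in a simplex of dimension at most
`n`: the superlevel sets of `a` form a chain, and all of them lie between `{k | 1 ≤ a k}` and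
`{k | 0 < a k}`. -/
lemma card_cubeCoord_pos_le (a : ι → ℝ) :
    (open Classical in Finset.univ.filter fun S => 0 < cubeCoord S a).card ≤
      (open Classical in Finset.univ.filter fun k => 0 < a k ∧ a k < 1).card + 1 := by
  classical
  set P := Finset.univ.filter fun k => 0 < a k
  set Q := Finset.univ.filter fun k => 1 ≤ a k
  set R := Finset.univ.filter fun k => 0 < a k ∧ a k < 1
  have hPQ : P.card ≤ R.card + Q.card := by
    refine (Finset.card_le_card fun k hk => ?_).trans (Finset.card_union_le R Q)
    simp only [P, Q, R, Finset.mem_union, Finset.mem_filter, Finset.mem_univ, true_and] at hk ⊢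
    rcases lt_or_ge (a k) 1 with h | h
    exacts [Or.inl ⟨hk, h⟩, Or.inr h]
  have hcard : (Finset.univ.filter fun S => 0 < cubeCoord S a).card ≤
      (Finset.Icc Q.card P.card).card := by
    refine Finset.card_le_card_of_injOn Finset.card ?_ ?_
    · intro S hS
      obtain ⟨θ, hθ, rfl⟩ := exists_level_of_cubeCoord_pos (by simpa using hS)
      simp only [Finset.coe_Icc, Set.mem_Icc]
      constructor <;> refine Finset.card_le_card fun k hk => ?_
      · simp only [Q, Finset.mem_filter, Finset.mem_univ, true_and] at hk ⊢
        exact hθ.2.trans hk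
      · simp only [P, Finset.mem_filter, Finset.mem_univ, true_and] at hk ⊢
        exact hθ.1.trans_le hk
    · intro S hS S' hS' hc
      obtain ⟨θ, -, rfl⟩ := exists_level_of_cubeCoord_pos (by simpa using hS)
      obtain ⟨θ', -, rfl⟩ := exists_level_of_cubeCoord_pos (by simpa using hS')
      rcases le_total θ θ' with h | h
      · refine (Finset.eq_of_subset_of_card_le (fun k hk => ?_) hc.le).symm
        simp only [Finset.mem_filter, Finset.mem_univ, true_and] at hk ⊢
        exact h.trans hk
      · refine Finset.eq_of_subset_of_card_le (fun k hk => ?_) hc.ge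
        simp only [Finset.mem_filter, Finset.mem_univ, true_and] at hk ⊢
        exact h.trans hk
  rw [Nat.card_Icc] at hcard
  omega

end Cube

/-! ### The nerve of a partition of unity -/

section Nerve

variable {k : ℕ}

/-- The vertices of the standard simplex in `ℝᵏ` are affinely independent. -/
lemma affineIndependent_range_single (k : ℕ) :
    AffineIndependent ℝ (fun x => x : Set.range
      (fun j : Fin k => EuclideanSpace.single j (1 : ℝ)) → EuclideanSpace ℝ (Fin k)) := by
  have h := (EuclideanSpace.basisFun (Fin k) ℝ).toBasis.linearIndependent.affineIndependent.range
  have he : ⇑(EuclideanSpace.basisFun (Fin k) ℝ).toBasis =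
      fun j : Fin k => EuclideanSpace.single j (1 : ℝ) := by
    ext j; simp
  rwa [he] at h

/-- The nerve of a family of functions `ψ₀, …, ψₖ₋₁`: the subcomplex of the standard simplex in
`ℝᵏ` whose faces are the nonempty sets of vertices `j` on which the functions `ψⱼ` are
simultaneously positive at some point. -/
noncomputable def nerve (ψ : Fin k → X → ℝ) :
    Geometry.SimplicialComplex ℝ (EuclideanSpace ℝ (Fin k)) where
  faces := {s | s.Nonempty ∧ ∃ y, (s : Set (EuclideanSpace ℝ (Fin k))) ⊆
    (fun j => EuclideanSpace.single j (1 : ℝ)) '' {j | 0 < ψ j y}}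
  isRelLowerSet_faces := by
    rintro s ⟨hs, y, hy⟩
    exact ⟨hs, fun t ht hne => ⟨hne, y, (Finset.coe_subset.2 ht).trans hy⟩⟩
  indep := by
    rintro s ⟨-, y, hy⟩
    exact (affineIndependent_range_single k).mono (hy.trans (Set.image_subset_range _ _))
  inter_subset_convexHull := by
    classical
    rintro s t ⟨-, y, hy⟩ ⟨-, z, hz⟩
    have h : AffineIndependent ℝ ((↑) : ↑(s ∪ t) → EuclideanSpace ℝ (Fin k)) := by
      refine (affineIndependent_range_single k).mono ?_
      rw [Finset.coe_union]
      exact Set.union_subset (hy.trans (Set.image_subset_range _ _))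
        (hz.trans (Set.image_subset_range _ _))
    exact (h.convexHull_inter').ge

lemma nerve_faces_finite (ψ : Fin k → X → ℝ) : (nerve ψ).faces.Finite := by
  refine Set.Finite.subset (Finset.finite_toSet (Set.finite_range
    (fun j : Fin k => EuclideanSpace.single j (1 : ℝ))).toFinset.powerset) ?_
  rintro s ⟨-, y, hy⟩
  rw [Finset.mem_coe, Finset.mem_powerset]
  intro v hv
  simpa using Set.image_subset_range _ _ (hy hv)

/-- The point of `ℝᵏ` with the coordinates `ψⱼ x`. -/
noncomputable def nerveMap (ψ : Fin k → X → ℝ) (x : X) : EuclideanSpace ℝ (Fin k) :=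
  WithLp.toLp 2 fun j => ψ j x

lemma pos_subset_of_mem_convexHull {ψ : Fin k → X → ℝ} {x y : X}
    (h : nerveMap ψ x ∈ convexHull ℝ
      ((fun j => EuclideanSpace.single j (1 : ℝ)) '' {j | 0 < ψ j y})) {j : Fin k}
    (hj : 0 < ψ j x) : 0 < ψ j y := by
  by_contra hy
  have hconv : Convex ℝ {v : EuclideanSpace ℝ (Fin k) | v j = 0} := by
    intro u hu v hv a b _ _ _
    simp only [Set.mem_ofPred_eq] at hu hv ⊢
    simp [hu, hv]
  have := convexHull_min (s := (fun j => EuclideanSpace.single j (1 : ℝ)) '' {j | 0 < ψ j y})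
    (by
      rintro _ ⟨i, hi, rfl⟩
      have : j ≠ i := by rintro rfl; exact hy hi
      simp [this]) hconv h
  have : ψ j x = 0 := this
  linarith

lemma exists_face_nerveMap {ψ : Fin k → X → ℝ} (h0 : ∀ j x, 0 ≤ ψ j x)
    (h1 : ∀ x, ∑ j, ψ j x = 1) (x : X) :
    ∃ s ∈ (nerve ψ).faces, nerveMap ψ x ∈ convexHull ℝ (s : Set (EuclideanSpace ℝ (Fin k))) := by
  classical
  set J := Finset.univ.filter fun j => 0 < ψ j x with hJ
  have hsum : ∑ j ∈ J, ψ j x = 1 := by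
    rw [← h1 x, hJ, Finset.sum_filter]
    refine Finset.sum_congr rfl fun j _ => ?_
    split_ifs with h
    · rfl
    · exact le_antisymm (h0 j x) (not_lt.1 h)
  have hne : J.Nonempty := by
    rw [Finset.nonempty_iff_ne_empty]; rintro h; simp [h] at hsum
  refine ⟨J.image fun j => EuclideanSpace.single j (1 : ℝ), ⟨hne.image _, x, ?_⟩, ?_⟩
  · simp [hJ]
  · have : nerveMap ψ x = ∑ j ∈ J, ψ j x • EuclideanSpace.single j (1 : ℝ) := by
      ext i
      simp only [nerveMap, WithLp.ofLp_sum, WithLp.ofLp_smul, Finset.sum_apply, Pi.smul_apply,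
        PiLp.single_apply, smul_eq_mul, mul_ite, mul_one, mul_zero]
      rw [Finset.sum_ite_eq]
      split_ifs with h
      · rfl
      · simp only [hJ, Finset.mem_filter, Finset.mem_univ, true_and, not_lt] at h
        exact le_antisymm h (h0 i x)
    rw [this]
    exact (convex_convexHull ℝ _).sum_mem (fun j _ => h0 j x) hsum fun j hj =>
      subset_convexHull ℝ _ (by simpa using ⟨j, hj, rfl⟩)

/-- A simplex of the nerve that realises the local dimension at the image of `x` is a face of the
simplex spanned by the functions that are positive at some `y`. That simplex contains the image of
`x`, so every function that is positive at `x` is positive at `y`. -/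
lemma exists_localDim_nerve_lt {ψ : Fin k → X → ℝ} (h0 : ∀ j x, 0 ≤ ψ j x)
    (h1 : ∀ x, ∑ j, ψ j x = 1) (x : X) :
    ∃ y, (∃ j, 0 < ψ j x ∧ 0 < ψ j y) ∧ localDim (nerve ψ) (nerveMap ψ x) <
      (open Classical in Finset.univ.filter fun j => 0 < ψ j y).card := by
  classical
  set D := {n | ∃ s ∈ (nerve ψ).faces,
    nerveMap ψ x ∈ convexHull ℝ (s : Set (EuclideanSpace ℝ (Fin k))) ∧ s.card = n + 1}
  have hcard : ∀ (s : Finset (EuclideanSpace ℝ (Fin k))) y,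
      (s : Set (EuclideanSpace ℝ (Fin k))) ⊆
        (fun j => EuclideanSpace.single j (1 : ℝ)) '' {j | 0 < ψ j y} →
      s.card ≤ (Finset.univ.filter fun j => 0 < ψ j y).card := by
    intro s y hs
    refine (Finset.card_le_card (t := (Finset.univ.filter fun j => 0 < ψ j y).image
      fun j => EuclideanSpace.single j (1 : ℝ)) ?_).trans Finset.card_image_le
    rw [← Finset.coe_subset]
    simpa using hs
  have hD : sSup D ∈ D := by
    refine Nat.sSup_mem ?_ ⟨k, ?_⟩
    · obtain ⟨s, hs, hx⟩ := exists_face_nerveMap h0 h1 x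
      exact ⟨s.card - 1, s, hs, hx, (Nat.succ_pred_eq_of_pos hs.1.card_pos).symm⟩
    · rintro n ⟨s, ⟨-, y, hy⟩, -, hn⟩
      have := (hcard s y hy).trans (Finset.card_le_univ _)
      rw [Fintype.card_fin] at this
      omega
  obtain ⟨s, ⟨-, y, hy⟩, hx, hn⟩ := hD
  obtain ⟨j, -, hj⟩ : ∃ j ∈ Finset.univ, 0 < ψ j x := by
    by_contra! h
    linarith [Finset.sum_nonpos h, h1 x]
  refine ⟨y, ⟨j, hj, pos_subset_of_mem_convexHull (convexHull_mono hy hx) hj⟩, ?_⟩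
  have := hcard s y hy
  change sSup D < _
  omega

/-- A partition of unity with small supports, on which `φ` oscillates by at most `w`, bounds the
width dimension by its order. -/
lemma widim_le_of_partition [TopologicalSpace X] {J : Type*} [Fintype J] {ρ : X → X → ℝ}
    {φ : X → ℝ} {η R w : ℝ} (hη : 0 < η) (ψ : J → X → ℝ) (hc : ∀ j, Continuous (ψ j))
    (h0 : ∀ j x, 0 ≤ ψ j x) (h1 : ∀ x, ∑ j, ψ j x = 1)
    (hρ : ∀ j x y, 0 < ψ j x → 0 < ψ j y → ρ x y ≤ η / 2)
    (hφ : ∀ j x y, 0 < ψ j x → 0 < ψ j y → φ x ≤ φ y + w)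
    (hR : ∀ x, (open Classical in (Finset.univ.filter fun j => 0 < ψ j x).card : ℝ) + φ x
      ≤ R + 1) :
    widim ρ φ η ≤ ((R + w : ℝ) : EReal) := by
  classical
  set e := Fintype.equivFin J
  set χ : Fin (Fintype.card J) → X → ℝ := fun i => ψ (e.symm i) with hχ
  have h0' : ∀ i x, 0 ≤ χ i x := fun i x => h0 _ x
  have h1' : ∀ x, ∑ i, χ i x = 1 := fun x => by
    rw [← h1 x]; exact Equiv.sum_comp e.symm fun j => ψ j x
  have hcard : ∀ y, (Finset.univ.filter fun i => 0 < χ i y).card =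
      (Finset.univ.filter fun j => 0 < ψ j y).card := fun y =>
    Finset.card_equiv e.symm (by simp [hχ])
  refine sInf_le_of_le ⟨_, nerve χ, nerveMap χ, nerve_faces_finite χ, ?_, ?_, ?_, rfl⟩ ?_
  · exact (PiLp.continuous_toLp 2 _).comp (continuous_pi fun i => hc _)
  · intro x
    obtain ⟨s, hs, hx⟩ := exists_face_nerveMap h0' h1' x
    exact Geometry.SimplicialComplex.mem_space_iff.2 ⟨s, hs, hx⟩
  · intro a
    refine lt_of_le_of_lt ?_ (ENNReal.ofReal_lt_ofReal_iff hη |>.2 (half_lt_self hη))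
    refine iSup₂_le fun x hx => iSup₂_le fun y hy => ENNReal.ofReal_le_ofReal ?_
    obtain ⟨j, -, hj⟩ : ∃ j ∈ Finset.univ, 0 < ψ j x := by
      by_contra! h
      linarith [Finset.sum_nonpos h, h1 x]
    have hxy : nerveMap χ x = nerveMap χ y := by rw [hx, hy]
    have hjy : χ (e j) x = χ (e j) y := congrArg (fun v => v (e j)) hxy
    simp only [hχ, Equiv.symm_apply_apply] at hjy
    exact hρ j x y hj (hjy ▸ hj)
  · refine iSup_le fun x => EReal.coe_le_coe_iff.2 ?_
    obtain ⟨y, ⟨i, hix, hiy⟩, hlt⟩ := exists_localDim_nerve_lt h0' h1' x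
    rw [hcard] at hlt
    have hlt' : (localDim (nerve χ) (nerveMap χ x) : ℝ) + 1 ≤
        ((Finset.univ.filter fun j => 0 < ψ j y).card : ℝ) := by exact_mod_cast hlt
    linarith [hR y, hφ _ x y hix hiy]

end Nerve

/-! ### Levels that the map hits in few coordinates -/

section Volume

open MeasureTheory

variable {ι : Type*} [Fintype ι] {D : X → X → ℝ} {φ : X → ℝ} {F : X → ι → ℝ} {L ε s τ : ℝ}

/-- The contribution of one covering set `E` to the volume estimate: the points `x` of `E` with
`s + τ ≤ |A| + φ x` have levels in a box with `|A|` sides of length at most `2 L diam E`, and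
`|A| ≥ τ + (s - sup_E φ)` as soon as there is such a point. -/
lemma volume_coincidence_inter_le (hL : 1 ≤ L) (hF : ∀ x y k, |F x k - F y k| ≤ L * D x y)
    (hε1 : ε ≤ 1) (hτ : 0 ≤ τ) (hs : ∀ x, φ x ≤ s) (A : Finset ι) (E : Set X)
    (hE : diamOf D E < ENNReal.ofReal ε) :
    volume {t : ι → ℝ | (∀ k, t k ∈ Set.Ioo (0 : ℝ) 1) ∧
        ∃ x ∈ E, s + τ ≤ A.card + φ x ∧ ∀ k ∈ A, F x k = t k} ≤
      ENNReal.ofReal (2 * L) ^ Fintype.card ι * ENNReal.ofReal ε ^ τ * hausdorffWeight D φ s E := by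
  classical
  by_cases hx : ∃ x ∈ E, s + τ ≤ A.card + φ x
  swap
  · push Not at hx
    rw [show {t : ι → ℝ | (∀ k, t k ∈ Set.Ioo (0 : ℝ) 1) ∧
        ∃ x ∈ E, s + τ ≤ A.card + φ x ∧ ∀ k ∈ A, F x k = t k} = ∅ from ?_]
    · simp
    · refine Set.eq_empty_of_forall_notMem ?_
      rintro t ⟨-, x, hxE, h, -⟩
      exact absurd h (not_le.2 (hx x hxE))
  obtain ⟨x₀, hx₀, hA⟩ := hx
  set r := diamOf D E with hr
  have hr1 : r ≤ 1 := hE.le.trans (by simpa using hε1)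
  have hrt : r ≠ ⊤ := ne_top_of_le_ne_top ENNReal.one_ne_top hr1
  have hD : ∀ x ∈ E, D x x₀ ≤ r.toReal := fun x hxE =>
    (ENNReal.ofReal_le_iff_le_toReal hrt).1
      ((le_iSup₂_of_le x hxE (le_iSup₂_of_le x₀ hx₀ le_rfl)))
  have hsub : {t : ι → ℝ | (∀ k, t k ∈ Set.Ioo (0 : ℝ) 1) ∧
      ∃ x ∈ E, s + τ ≤ A.card + φ x ∧ ∀ k ∈ A, F x k = t k} ⊆
      Set.pi Set.univ fun k => if k ∈ A then
        Set.Icc (F x₀ k - L * r.toReal) (F x₀ k + L * r.toReal) else Set.Ioo 0 1 := by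
    rintro t ⟨ht, x, hxE, -, hxt⟩ k -
    dsimp only
    split_ifs with hk
    · have h1 := hF x x₀ k
      have h2 : L * D x x₀ ≤ L * r.toReal :=
        mul_le_mul_of_nonneg_left (hD x hxE) (by linarith)
      rw [hxt k hk] at h1
      have := abs_le.1 (h1.trans h2)
      constructor <;> linarith [this.1, this.2]
    · exact ht k
  have hvol : volume (Set.pi Set.univ fun k => if k ∈ A then
      Set.Icc (F x₀ k - L * r.toReal) (F x₀ k + L * r.toReal) else Set.Ioo (0 : ℝ) 1) =
      (ENNReal.ofReal (2 * L) * r) ^ A.card := by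
    rw [volume_pi_pi, ← Finset.prod_const, ← Finset.prod_subset (Finset.subset_univ A)]
    · refine Finset.prod_congr rfl fun k hk => ?_
      rw [if_pos hk, Real.volume_Icc]
      conv_rhs => rw [← ENNReal.ofReal_toReal hrt]
      rw [← ENNReal.ofReal_mul (by linarith)]
      congr 1; ring
    · intro k _ hk
      simp [hk]
  have hsup : φ x₀ ≤ sSup (φ '' E) :=
    le_csSup ⟨s, by rintro _ ⟨x, -, rfl⟩; exact hs x⟩ ⟨x₀, hx₀, rfl⟩
  have hsup' : sSup (φ '' E) ≤ s :=
    csSup_le ⟨_, x₀, hx₀, rfl⟩ (by rintro _ ⟨x, -, rfl⟩; exact hs x)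
  have hpow : r ^ A.card ≤ ENNReal.ofReal ε ^ τ * hausdorffWeight D φ s E := by
    rw [hausdorffWeight, if_neg (Set.nonempty_iff_ne_empty.1 ⟨x₀, hx₀⟩), ← ENNReal.rpow_natCast]
    calc r ^ (A.card : ℝ) ≤ r ^ (τ + (s - sSup (φ '' E))) :=
          ENNReal.rpow_le_rpow_of_exponent_ge hr1 (by linarith)
      _ = r ^ τ * r ^ (s - sSup (φ '' E)) :=
          ENNReal.rpow_add_of_nonneg _ _ hτ (by linarith)
      _ ≤ _ := by gcongr
  have h2L : 1 ≤ ENNReal.ofReal (2 * L) := by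
    rw [← ENNReal.ofReal_one]; exact ENNReal.ofReal_le_ofReal (by linarith)
  calc _ ≤ (ENNReal.ofReal (2 * L) * r) ^ A.card := hvol ▸ measure_mono hsub
    _ = ENNReal.ofReal (2 * L) ^ A.card * r ^ A.card := mul_pow _ _ _
    _ ≤ ENNReal.ofReal (2 * L) ^ Fintype.card ι *
        (ENNReal.ofReal ε ^ τ * hausdorffWeight D φ s E) :=
      mul_le_mul' (pow_le_pow_right₀ h2L A.card_le_univ) hpow
    _ = _ := (mul_assoc _ _ _).symm

/-- If the weighted Hausdorff sum at scale `ε` is less than `1`, then some level `t` in the open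
cube is hit by `F x` in fewer than `s + τ - φ x` coordinates, for every `x`: the levels that violate
this have total volume less than `1`. -/
lemma exists_level (hL : 1 ≤ L) (hF : ∀ x y k, |F x k - F y k| ≤ L * D x y)
    (hε1 : ε ≤ 1) (hτ : 0 ≤ τ) (hs : ∀ x, φ x ≤ s) (hH : hausdorffSum D φ ε s < 1)
    (hsmall : ENNReal.ofReal (4 * L) ^ Fintype.card ι * ENNReal.ofReal ε ^ τ < 1) :
    ∃ t : ι → ℝ, (∀ k, t k ∈ Set.Ioo (0 : ℝ) 1) ∧
      ∀ (A : Finset ι) (x : X), s + τ ≤ A.card + φ x → ∃ k ∈ A, F x k ≠ t k := by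
  classical
  obtain ⟨_, ⟨E, hcov, hE, rfl⟩, hsum⟩ := sInf_lt_iff.1 hH
  by_contra! hcon
  set B : Finset ι → ℕ → Set (ι → ℝ) := fun A i => {t | (∀ k, t k ∈ Set.Ioo (0 : ℝ) 1) ∧
    ∃ x ∈ E i, s + τ ≤ A.card + φ x ∧ ∀ k ∈ A, F x k = t k}
  have hsub : (Set.pi Set.univ fun _ : ι => Set.Ioo (0 : ℝ) 1) ⊆ ⋃ A, ⋃ i, B A i := by
    intro t ht
    have ht' : ∀ k, t k ∈ Set.Ioo (0 : ℝ) 1 := fun k => ht k trivial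
    obtain ⟨A, x, hA, hx⟩ := hcon t ht'
    obtain ⟨i, hi⟩ := Set.mem_iUnion.1 (hcov ▸ Set.mem_univ x : x ∈ ⋃ i, E i)
    exact Set.mem_iUnion.2 ⟨A, Set.mem_iUnion.2 ⟨i, ht', x, hi, hA, hx⟩⟩
  have hBA : ∀ A, volume (⋃ i, B A i) ≤
      ENNReal.ofReal (2 * L) ^ Fintype.card ι * ENNReal.ofReal ε ^ τ := fun A =>
    calc volume (⋃ i, B A i) ≤ ∑' i, volume (B A i) := measure_iUnion_le _
      _ ≤ ∑' i, ENNReal.ofReal (2 * L) ^ Fintype.card ι * ENNReal.ofReal ε ^ τ *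
          hausdorffWeight D φ s (E i) :=
        ENNReal.tsum_le_tsum fun i => volume_coincidence_inter_le hL hF hε1 hτ hs A _ (hE i)
      _ ≤ ENNReal.ofReal (2 * L) ^ Fintype.card ι * ENNReal.ofReal ε ^ τ := by
        rw [ENNReal.tsum_mul_left]
        exact mul_le_of_le_one_right' hsum.le
  have h1 : (1 : ℝ≥0∞) ≤ ENNReal.ofReal (4 * L) ^ Fintype.card ι * ENNReal.ofReal ε ^ τ :=
    calc (1 : ℝ≥0∞) = volume (Set.pi Set.univ fun _ : ι => Set.Ioo (0 : ℝ) 1) := by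
          simp [volume_pi_pi]
      _ ≤ ∑ A, volume (⋃ i, B A i) :=
        (measure_mono hsub).trans (measure_iUnion_fintype_le _ _)
      _ ≤ ∑ _A : Finset ι, ENNReal.ofReal (2 * L) ^ Fintype.card ι * ENNReal.ofReal ε ^ τ :=
        Finset.sum_le_sum fun A _ => hBA A
      _ = ENNReal.ofReal (4 * L) ^ Fintype.card ι * ENNReal.ofReal ε ^ τ := by
        rw [Finset.sum_const, Finset.card_univ, Fintype.card_finset, nsmul_eq_mul, ← mul_assoc]
        congr 1
        push_cast
        rw [← mul_pow, ← ENNReal.ofReal_ofNat 2, ← ENNReal.ofReal_mul (by norm_num)]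
        congr 2; ring
  exact absurd hsmall (not_lt.2 h1)

/-- By compactness, a level that is hit in few coordinates is also nearly hit in few coordinates. -/
lemma exists_margin [TopologicalSpace X] [CompactSpace X] (hFc : ∀ k, Continuous fun x => F x k)
    (hφc : Continuous φ) {t : ι → ℝ} (ht : ∀ k, t k ∈ Set.Ioo (0 : ℝ) 1)
    (hA : ∀ (A : Finset ι) (x : X), s + τ ≤ A.card + φ x → ∃ k ∈ A, F x k ≠ t k) :
    ∃ δ > 0, (∀ k, δ ≤ t k ∧ t k + δ ≤ 1) ∧
      ∀ (A : Finset ι) (x : X), s + τ ≤ A.card + φ x → ∃ k ∈ A, δ ≤ |F x k - t k| := by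
  have h1 : ∀ᶠ δ in 𝓝[>] (0 : ℝ), ∀ k, δ ≤ t k ∧ t k + δ ≤ 1 := by
    refine eventually_all.2 fun k => ?_
    filter_upwards [Ioo_mem_nhdsGT (lt_min (ht k).1 (sub_pos.2 (ht k).2))] with δ hδ
    have := lt_min_iff.1 hδ.2
    constructor <;> linarith
  have h2 : ∀ᶠ δ in 𝓝[>] (0 : ℝ), ∀ A : Finset ι, ∀ x, s + τ ≤ A.card + φ x →
      ∃ k ∈ A, δ ≤ |F x k - t k| := by
    refine eventually_all.2 fun A => ?_
    set K := {x | s + τ ≤ A.card + φ x} with hK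
    have hKc : IsCompact K := (isClosed_le continuous_const (by fun_prop)).isCompact
    rcases K.eq_empty_or_nonempty with hKe | hKne
    · refine Eventually.of_forall fun δ x hx => ?_
      exact absurd (show x ∈ K from hx) (hKe ▸ Set.notMem_empty x)
    set g : X → ℝ := fun x => ‖fun k : A => F x k - t k‖ with hg
    have hgc : Continuous g :=
      (continuous_pi fun k : A => (hFc k).sub continuous_const).norm
    obtain ⟨x₀, hx₀, hmin⟩ := hKc.exists_isMinOn hKne hgc.continuousOn
    have hpos : 0 < g x₀ := by
      obtain ⟨k, hk, hne⟩ := hA A x₀ hx₀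
      refine norm_pos_iff.2 fun h => hne ?_
      have := congrFun h ⟨k, hk⟩
      simpa [sub_eq_zero] using this
    filter_upwards [Ioo_mem_nhdsGT hpos] with δ hδ x hx
    by_contra! hcon
    have hlt : g x < δ := (pi_norm_lt_iff hδ.1).2 fun k => by
      simpa using hcon k k.2
    exact absurd (hmin hx) (not_le.2 (hlt.trans hδ.2))
  obtain ⟨δ, ⟨hδ1, hδ2⟩, hδ⟩ := ((h1.and h2).and self_mem_nhdsWithin).exists
  exact ⟨δ, hδ, hδ1, hδ2⟩

end Volume

/-! ### Mean dimension and mean Hausdorff dimension -/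

lemma widim_le_of_hausdorffSum_lt [TopologicalSpace X] [CompactSpace X] {ι : Type*} [Fintype ι]
    {D ρ : X → X → ℝ} {φ : X → ℝ} {F : X → ι → ℝ} {L ε s τ η w : ℝ} (hL : 1 ≤ L)
    (hF : ∀ x y k, |F x k - F y k| ≤ L * D x y) (hFc : ∀ k, Continuous fun x => F x k)
    (hφc : Continuous φ) (hε1 : ε ≤ 1) (hτ : 0 ≤ τ) (hs : ∀ x, φ x ≤ s)
    (hH : hausdorffSum D φ ε s < 1)
    (hsmall : ENNReal.ofReal (4 * L) ^ Fintype.card ι * ENNReal.ofReal ε ^ τ < 1) (hη : 0 < η)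
    (hsep : ∀ x y, (∀ k, ¬ (F x k ≤ 0 ∧ 1 ≤ F y k)) → ρ x y ≤ η / 2 ∧ φ x ≤ φ y + w) :
    widim ρ φ η ≤ ((s + τ + w : ℝ) : EReal) := by
  classical
  obtain ⟨t, ht, htA⟩ := exists_level hL hF hε1 hτ hs hH hsmall
  obtain ⟨δ, hδ, hδt, hδA⟩ := exists_margin hFc hφc ht htA
  -- The values of `a` leave `(0, 1)` where a coordinate of `F` is at distance at least `δ` from the
  -- level `t`, while the values `≤ 0` and `≥ 1` of `F` are kept apart.
  set a : X → ι → ℝ := fun x k => 1 / 2 + (F x k - t k) / (2 * δ) with ha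
  have hac : Continuous a := continuous_pi fun k => by
    have := hFc k
    fun_prop
  have ha0 : ∀ x k, F x k ≤ 0 → a x k ≤ 0 := by
    intro x k h
    have : (F x k - t k) / (2 * δ) ≤ -(1 / 2) := by
      rw [div_le_iff₀ (by positivity)]; linarith [(hδt k).1]
    simp only [ha]; linarith
  have ha1 : ∀ x k, 1 ≤ F x k → 1 ≤ a x k := by
    intro x k h
    have : 1 / 2 ≤ (F x k - t k) / (2 * δ) := by
      rw [le_div_iff₀ (by positivity)]; linarith [(hδt k).2]
    simp only [ha]; linarith
  have haδ : ∀ x k, 0 < a x k → a x k < 1 → |F x k - t k| < δ := by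
    intro x k h0 h1
    have h2 : -(1 / 2) < (F x k - t k) / (2 * δ) := by simp only [ha] at h0; linarith
    have h3 : (F x k - t k) / (2 * δ) < 1 / 2 := by simp only [ha] at h1; linarith
    rw [lt_div_iff₀ (by positivity)] at h2
    rw [div_lt_iff₀ (by positivity)] at h3
    rw [abs_lt]; constructor <;> linarith
  have hshare : ∀ (S : Finset ι) x y, 0 < cubeCoord S (a x) → 0 < cubeCoord S (a y) →
      ρ x y ≤ η / 2 ∧ φ x ≤ φ y + w := fun S x y hx hy => hsep x y fun k hk =>
    notMem_of_cubeCoord_pos hx (ha0 x k hk.1) (mem_of_cubeCoord_pos hy (ha1 y k hk.2))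
  refine widim_le_of_partition hη (fun S x => cubeCoord S (a x))
    (fun S => (continuous_cubeCoord S).comp hac) (fun S x => cubeCoord_nonneg S _)
    (fun x => sum_cubeCoord _) (fun S x y hx hy => (hshare S x y hx hy).1)
    (fun S x y hx hy => (hshare S x y hx hy).2) fun x => ?_
  have hlt : ((Finset.univ.filter fun k => 0 < a x k ∧ a x k < 1).card : ℝ) + φ x < s + τ := by
    by_contra! h
    obtain ⟨k, hk, hk'⟩ := hδA _ x h
    simp only [Finset.mem_filter, Finset.mem_univ, true_and] at hk
    exact absurd (haδ x k hk.1 hk.2) (not_lt.2 hk')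
  have hcard : ((Finset.univ.filter fun S => 0 < cubeCoord S (a x)).card : ℝ) ≤
      (Finset.univ.filter fun k => 0 < a x k ∧ a x k < 1).card + 1 := by
    exact_mod_cast card_cubeCoord_pos_le (a x)
  linarith

/-- A Lipschitz map to some `ℝ^J` that separates points at distance at least `r`: up to scaling, the
distances to the points of a finite net. -/
lemma exists_lipschitz_separating [MetricSpace X] [CompactSpace X] {r : ℝ} (hr : 0 < r) :
    ∃ (J : Finset X) (f : X → J → ℝ) (L : ℝ), 1 ≤ L ∧ (∀ k, Continuous fun x => f x k) ∧
      (∀ x y k, |f x k - f y k| ≤ L * dist x y) ∧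
      ∀ x y, r ≤ dist x y → ∃ k, f x k ≤ 0 ∧ 1 ≤ f y k := by
  obtain ⟨J, -, hJf, hJ⟩ := finite_cover_balls_of_compact (isCompact_univ (X := X))
    (show 0 < r / 4 by positivity)
  refine ⟨hJf.toFinset, fun x k => 4 / r * dist x k - 1, max 1 (4 / r), le_max_left _ _, ?_, ?_, ?_⟩
  · intro k; fun_prop
  · intro x y k
    rw [show 4 / r * dist x k - 1 - (4 / r * dist y k - 1) =
      4 / r * (dist x k - dist y k) by ring, abs_mul, abs_of_pos (by positivity)]
    exact mul_le_mul (le_max_right _ _) (abs_dist_sub_le _ _ _) (abs_nonneg _)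
      (le_trans zero_le_one (le_max_left _ _))
  · intro x y hxy
    obtain ⟨p, hp, hxp⟩ := Set.mem_iUnion₂.1 (hJ (Set.mem_univ x))
    rw [Metric.mem_ball] at hxp
    have hyp : r ≤ dist x p + dist y p := hxy.trans (dist_triangle_right x y p)
    refine ⟨⟨p, by simpa using hp⟩, ?_, ?_⟩
    · have : 4 / r * dist x p ≤ 4 / r * (r / 4) := by gcongr
      rw [show 4 / r * (r / 4) = 1 by field_simp] at this
      simpa using this
    · have : 4 / r * (r / 2) ≤ 4 / r * dist y p := by gcongr; linarith
      rw [show 4 / r * (r / 2) = 2 by field_simp; norm_num] at this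
      simp only; linarith

/-- Any two compatible metrics of a compact space are uniformly equivalent. -/
lemma IsCompatibleMetric.exists_forall_lt [TopologicalSpace X] [CompactSpace X] {d ρ : X → X → ℝ}
    (hd : IsCompatibleMetric d) (hρ : IsCompatibleMetric ρ) {η : ℝ} (hη : 0 < η) :
    ∃ r > 0, ∀ x y, d x y < r → ρ x y < η := by
  obtain ⟨m, hm, hmd⟩ := hd
  obtain ⟨m', hm', hmρ⟩ := hρ
  have hu : m.toUniformSpace = m'.toUniformSpace := unique_uniformity_of_compact hm hm'
  have h : {p : X × X | m'.dist p.1 p.2 < η} ∈ @uniformity X m'.toUniformSpace :=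
    @Metric.dist_mem_uniformity X m'.toPseudoMetricSpace η hη
  rw [← hu] at h
  obtain ⟨r, hr, h⟩ := (@Metric.mem_uniformity_dist X m.toPseudoMetricSpace _).1 h
  refine ⟨r, hr, fun x y hxy => ?_⟩
  rw [← hmρ]
  rw [← hmd] at hxy
  exact h hxy

lemma le_bowenDist (T : X → X) (d : X → X → ℝ) {N : ℕ} (n : Fin N) (x y : X) :
    d (T^[n] x) (T^[n] y) ≤ bowenDist T d N x y :=
  le_ciSup (f := fun n : Fin N => d (T^[n] x) (T^[n] y)) (Set.finite_range _).bddAbove n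

lemma bowenDist_lt {T : X → X} {d : X → X → ℝ} {N : ℕ} (hN : 1 ≤ N) {r : ℝ} {x y : X}
    (h : ∀ n : Fin N, d (T^[n] x) (T^[n] y) < r) : bowenDist T d N x y < r := by
  have : Nonempty (Fin N) := ⟨⟨0, hN⟩⟩
  obtain ⟨n, hn⟩ := exists_eq_ciSup_of_finite (f := fun n : Fin N => d (T^[n] x) (T^[n] y))
  rw [bowenDist, ← hn]
  exact h n

/-- If `s > dim_H`, then `s ≥ max φ` and the weighted Hausdorff sum of exponent `s` is less than `1`.
The first claim holds since `dim_H ≥ max φ`: at `s = max φ`, a set that contains a maximum point of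
`φ` has weight `(diam E)⁰ = 1`. -/
lemma le_and_hausdorffSum_lt_of_dimHWith_lt [TopologicalSpace X] [CompactSpace X] [Nonempty X]
    {D : X → X → ℝ} {φ : X → ℝ} (hφ : Continuous φ) {ε s : ℝ} (h : dimHWith D φ ε < s) :
    (∀ x, φ x ≤ s) ∧ hausdorffSum D φ ε s < 1 := by
  obtain ⟨x₀, -, hx₀⟩ := isCompact_univ.exists_isMaxOn Set.univ_nonempty hφ.continuousOn
  have hmax : ∀ x, φ x ≤ φ x₀ := fun x => hx₀ (Set.mem_univ x)
  have h1 : 1 ≤ hausdorffSum D φ ε (φ x₀) := by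
    refine le_sInf ?_
    rintro _ ⟨E, hcov, -, rfl⟩
    obtain ⟨i, hi⟩ := Set.mem_iUnion.1 (hcov ▸ Set.mem_univ x₀ : x₀ ∈ ⋃ i, E i)
    refine le_trans (le_of_eq ?_) (ENNReal.le_tsum i)
    have hsup : sSup (φ '' E i) = φ x₀ :=
      IsGreatest.csSup_eq ⟨⟨x₀, hi, rfl⟩, by rintro _ ⟨x, -, rfl⟩; exact hmax x⟩
    rw [hausdorffWeight, if_neg (Set.nonempty_iff_ne_empty.1 ⟨x₀, hi⟩), hsup, sub_self,
      ENNReal.rpow_zero]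
  have hle : ((φ x₀ : ℝ) : EReal) < s := (le_sSup ⟨φ x₀, hmax, h1, rfl⟩ :
    ((φ x₀ : ℝ) : EReal) ≤ dimHWith D φ ε).trans_lt h
  have hs : ∀ x, φ x ≤ s := fun x => (hmax x).trans (EReal.coe_lt_coe_iff.1 hle).le
  refine ⟨hs, ?_⟩
  by_contra! hcon
  exact absurd h (not_lt.2 (le_sSup ⟨s, hs, hcon, rfl⟩))

lemma lt_mul_of_div_lt {u : EReal} {N : ℕ} (hN : 1 ≤ N) {c : ℝ} (h : u / (N : EReal) < c) :
    u < ((N * c : ℝ) : EReal) := by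
  by_contra! hcon
  refine absurd h (not_lt.2 ?_)
  rw [EReal.le_div_iff_mul_le (by exact_mod_cast hN) (EReal.natCast_ne_top N), mul_comm]
  exact_mod_cast hcon

theorem mdim_le_mdimH [TopologicalSpace X] [CompactSpace X] [Nonempty X] {T : X → X}
    (hT : Continuous T) {d ρ : X → X → ℝ} (hd : IsCompatibleMetric d) (hρ : IsCompatibleMetric ρ)
    {φ : ℕ → X → ℝ} (hφ : ∀ n, 1 ≤ n → Continuous (φ n)) (hbd : BoundedDistortion T d φ) :
    mdim T ρ φ ≤ mdimH T d φ := by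
  refine EReal.le_of_forall_lt_iff_le.1 fun D hD => ?_
  obtain ⟨D₀, hD₀, hD₀D⟩ := EReal.lt_iff_exists_real_btwn.1 hD
  rw [EReal.coe_lt_coe_iff] at hD₀D
  set κ := (D - D₀) / 2 with hκ
  have hκ0 : 0 < κ := by simp only [hκ]; linarith
  obtain ⟨r₀, hr₀var, hr₀⟩ := ((hbd.eventually_lt_const
    (show (0 : EReal) < (κ : ℝ) by exact_mod_cast hκ0)).and self_mem_nhdsWithin).exists
  refine limsup_le_of_le (h := ?_)
  filter_upwards [self_mem_nhdsWithin] with η (hη : 0 < η)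
  obtain ⟨r₁, hr₁, hr₁ρ⟩ := hd.exists_forall_lt hρ (half_pos hη)
  obtain ⟨J, f, L, hL, hfc, hfL, hfsep⟩ : ∃ (J : Finset X) (f : X → J → ℝ) (L : ℝ), 1 ≤ L ∧
      (∀ k, Continuous fun x => f x k) ∧ (∀ x y k, |f x k - f y k| ≤ L * d x y) ∧
      ∀ x y, min r₀ r₁ ≤ d x y → ∃ k, f x k ≤ 0 ∧ 1 ≤ f y k := by
    obtain ⟨m, rfl, hm⟩ := hd
    simpa only [← hm] using exists_lipschitz_separating (lt_min hr₀ hr₁)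
  have hsmall : ∀ᶠ ε in 𝓝[>] (0 : ℝ),
      ENNReal.ofReal (4 * L) ^ J.card * ENNReal.ofReal ε ^ κ < 1 := by
    have h1 : Tendsto (fun ε : ℝ => ENNReal.ofReal ε ^ κ) (𝓝[>] 0) (𝓝 0) := by
      have : Tendsto (fun ε : ℝ => ENNReal.ofReal ε ^ κ) (𝓝 0) (𝓝 (ENNReal.ofReal 0 ^ κ)) :=
        (ENNReal.continuous_rpow_const.comp ENNReal.continuous_ofReal).tendsto 0
      rw [ENNReal.ofReal_zero, ENNReal.zero_rpow_of_pos hκ0] at this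
      exact this.mono_left nhdsWithin_le_nhds
    have h2 := ENNReal.Tendsto.const_mul h1
      (Or.inr (ENNReal.pow_ne_top (ENNReal.ofReal_ne_top (r := 4 * L)) (n := J.card)))
    rw [mul_zero] at h2
    exact h2.eventually_lt_const one_pos
  obtain ⟨ε, hεD, hεsmall, hε0, hε1⟩ := ((eventually_lt_of_limsup_lt hD₀).and
    (hsmall.and (Ioo_mem_nhdsGT one_pos))).exists
  refine limsup_le_of_le (h := ?_)
  filter_upwards [eventually_lt_of_limsup_lt hεD, eventually_lt_of_limsup_lt hr₀var,
    eventually_ge_atTop 1] with N hNdim hNvar hN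
  obtain ⟨hs, hH⟩ := le_and_hausdorffSum_lt_of_dimHWith_lt (hφ N hN) (lt_mul_of_div_lt hN hNdim)
  have hvar := lt_mul_of_div_lt hN hNvar
  have hw := widim_le_of_hausdorffSum_lt (ι := Fin N × J) (D := bowenDist T d N)
    (ρ := bowenDist T ρ N) (F := fun x k => f (T^[k.1] x) k.2) (τ := N * κ) (w := N * κ) hL
    (fun x y k => (hfL _ _ _).trans
      (mul_le_mul_of_nonneg_left (le_bowenDist T d k.1 x y) (by linarith)))
    (fun k => (hfc k.2).comp (hT.iterate _)) (hφ N hN) hε1.le (by positivity) hs hH ?_ hη ?_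
  · rw [EReal.div_le_iff_le_mul (by exact_mod_cast hN) (EReal.natCast_ne_top N)]
    refine hw.trans (le_of_eq ?_)
    rw [show (N * D₀ + N * κ + N * κ : ℝ) = N * D by simp only [hκ]; ring]
    norm_cast
  · rw [Fintype.card_prod, Fintype.card_fin, Fintype.card_coe, mul_comm N, mul_comm (N : ℝ),
      pow_mul, ENNReal.rpow_mul, ENNReal.rpow_natCast, ← mul_pow]
    exact pow_lt_one₀ zero_le hεsmall (by omega)
  · intro x y hxy
    have hdr : ∀ n : Fin N, d (T^[n] x) (T^[n] y) < min r₀ r₁ := by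
      intro n
      by_contra! h
      obtain ⟨k, hk⟩ := hfsep _ _ h
      exact hxy (n, k) hk
    refine ⟨(bowenDist_lt hN fun n => hr₁ρ _ _ ((hdr n).trans_le (min_le_right _ _))).le, ?_⟩
    have hle : ((|φ N x - φ N y| : ℝ) : EReal) ≤ varOf (bowenDist T d N) (φ N) r₀ :=
      le_iSup_of_le x (le_iSup_of_le y (le_iSup_of_le
        (bowenDist_lt hN fun n => (hdr n).trans_le (min_le_left _ _)) le_rfl))
    have := EReal.coe_lt_coe_iff.1 (hle.trans_lt hvar)
    linarith [(abs_lt.1 this).2]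

end SubadditiveMeanDim

theorem mainTheorem4 {X : Type*} [TopologicalSpace X] [CompactSpace X] [Nonempty X]
    (T : X ≃ₜ X) (d : X → X → ℝ) (hd : SubadditiveMeanDim.IsCompatibleMetric d)
    (φ : ℕ → X → ℝ) (hφ : SubadditiveMeanDim.IsSubadditivePotential T φ) :
    SubadditiveMeanDim.mdimH T d φ ≤ SubadditiveMeanDim.lowerMdimM T d φ ∧
    (SubadditiveMeanDim.BoundedDistortion T d φ →
      (∃ K : ℝ, 0 < K ∧ ∀ n, 1 ≤ n → ∀ x, |φ (n + 1) x - φ n x| < K) →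
      ∀ ρ : X → X → ℝ, SubadditiveMeanDim.IsCompatibleMetric ρ →
        SubadditiveMeanDim.mdim T ρ φ ≤ SubadditiveMeanDim.mdimH T d φ) :=
  ⟨SubadditiveMeanDim.mdimH_le_lowerMdimM T d φ, fun hbd _ _ hρ =>
    SubadditiveMeanDim.mdim_le_mdimH T.continuous hd hρ hφ.continuous hbd⟩
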